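/- Let $\mathcal A$ be an abelian category with enough projectives and let $\mathcal P$ be its class of projective objects. Let $\underline{\mathcal A}$ be the projectively stable category: it has the objects of $\mathcal A$ (written $\underline A$), and morphisms are those of $\mathcal A$ modulo the morphisms factoring through a projective object. Choosing for every $A$ an exact sequence $0\to\Omega A\to P\to A\to 0$ with $P$ projective gives the syzygy functor $\Omega\colon\underline{\mathcal A}\to\underline{\mathcal A}$. The costabilization $\mathcal R(\underline{\mathcal A})$ has as objects the sequences $(A_n,\alpha_n)_{n\in\mathbb Z}$ of objects $A_n$ of $\underline{\mathcal A}$ and isomorphisms $\alpha_n\colon A_n\xrightarrow{\cong}\Omega A_{n+1}$ in $\underline{\mathcal A}$, and as morphisms $(A_n,\alpha_n)\to(B_n,\beta_n)$ the sequences $(f_n)_{n\in\mathbb Z}$ of morphisms $f_n\colon A_n\to B_n$ in $\underline{\mathcal A}$ with $\beta_n\circ f_n=\Omega(f_{n+1})\circ\alpha_n$ for all $n$. Let $R\colon\mathcal R(\underline{\mathcal A})\to\underline{\mathcal A}$ be the forgetful functor $(A_n,\alpha_n)\mapsto A_0$, $(f_n)\mapsto f_0$, and let $\operatorname{im}R$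 be its essential image. The category $\mathcal A$ is called $\mathcal P$-Co-Gorenstein if $R$ is full and faithful and, for every short exact sequence $0\to A_1\to A_2\to A_3\to 0$ in $\mathcal A$ with $\underline{A_1},\underline{A_3}\in\operatorname{im}R$, also $\underline{A_2}\in\operatorname{im}R$. Let $\Omega^\infty(\mathcal A)$ be the class of objects $A$ for which there is an exact sequence $0\to A\to P_0\to P_1\to\cdots$ with all $P_i$ projective. Let ${}^{{}_1\perp}\mathcal P$ be the class of objects $A$ with $\operatorname{Ext}^1_{\mathcal A}(A,P)=0$ for all $P\in\mathcal P$, and ${}^{\perp}\mathcal P$ the class of objects $A$ with $\operatorname{Ext}^i_{\mathcal A}(A,P)=0$ for all $P\in\mathcal P$ and all $i\ge 1$. An object is Gorenstein projective if it is isomorphic to the kernel of $d_0\colon P_0\to P_1$ for some acyclic complex $(P_n,d_n\colon P_n\to P_{n+1})_{n\in\mathbb Z}$ of projective objects for which the complex $\operatorname{Hom}_{\mathcal A}(P_\bullet,Q)$ is acyclic for every $Q\in\mathcal P$; let $\mathcal{GP}(\mathcal A)$ be the class of these objects. Then the following statements are equivalent: 1. $\mathcal A$ is $\mathcal P$-Co-Gorenstein;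 2. $\Omega^\infty(\mathcal A)\subseteq{}^{{}_1\perp}\mathcal P$; 3. $\Omega^\infty(\mathcal A)\subseteq{}^{\perp}\mathcal P$; 4. $\Omega^\infty(\mathcal A)=\mathcal{GP}(\mathcal A)$. -/

import Mathlib

open CategoryTheory CategoryTheory.Limits

universe v u

namespace CoGor

section Costabilization

variable {D : Type u} [Category.{v} D]

/-- Objects of the costabilization of a category `D` with an endofunctor `T`: sequences of objects
`C_n` indexed by `n : ℤ`, with isomorphisms `α_n : C_n ≅ T C_{n+1}`. -/
structure Costabilization (T : D ⥤ D) where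
  obj : ℤ → D
  iso : ∀ n : ℤ, obj n ≅ T.obj (obj (n + 1))

namespace Costabilization

variable {T : D ⥤ D}

/-- Morphisms `(C_n, α_n) ⟶ (C'_n, β_n)`: sequences `f_n` with `β_n ∘ f_n = T(f_{n+1}) ∘ α_n`. -/
@[ext]
structure Hom (X Y : Costabilization T) where
  hom : ∀ n : ℤ, X.obj n ⟶ Y.obj n
  comm : ∀ n : ℤ, hom n ≫ (Y.iso n).hom = (X.iso n).hom ≫ T.map (hom (n + 1))

instance : Category (Costabilization T) where
  Hom X Y := Hom X Y
  id X := { hom := fun n => 𝟙 (X.obj n), comm := fun n => by simp }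
  comp f g :=
    { hom := fun n => f.hom n ≫ g.hom n
      comm := fun n => by
        rw [Category.assoc, g.comm, ← Category.assoc, f.comm, Category.assoc, T.map_comp] }
  id_comp f := Hom.ext (funext fun n => Category.id_comp (f.hom n))
  comp_id f := Hom.ext (funext fun n => Category.comp_id (f.hom n))
  assoc f g h := Hom.ext (funext fun n => Category.assoc (f.hom n) (g.hom n) (h.hom n))

/-- The forgetful functor, sending `(C_n, α_n)` to `C_0`. -/
def forget (T : D ⥤ D) : Costabilization T ⥤ D where
  obj X := X.obj 0
  map f := Hom.hom f 0

end Costabilization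

end Costabilization

section Stable

variable (C : Type u) [Category.{v} C] [Abelian C]

/-- Two parallel morphisms are related if their difference factors through a projective object. -/
def stableRel : HomRel C := fun X Y f g =>
  ∃ (Q : C) (_ : Projective Q) (a : X ⟶ Q) (b : Q ⟶ Y), f - g = a ≫ b

open scoped ZeroObject in
instance : Congruence (stableRel C) where
  comp_left := by
    rintro X Y Z f g g' ⟨Q, hQ, a, b, h⟩
    exact ⟨Q, hQ, f ≫ a, b, by rw [← Preadditive.comp_sub, h, Category.assoc]⟩
  comp_right := by
    rintro X Y Z f f' g ⟨Q, hQ, a, b, h⟩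
    exact ⟨Q, hQ, a, b ≫ g, by rw [← Preadditive.sub_comp, h, Category.assoc]⟩
  equivalence :=
    { refl := fun f => ⟨(0 : C), inferInstance, 0, 0, by simp⟩
      symm := by
        rintro f g ⟨Q, hQ, a, b, h⟩
        exact ⟨Q, hQ, -a, b, by rw [← neg_sub, h, Preadditive.neg_comp]⟩
      trans := by
        rintro f g k ⟨Q, hQ, a, b, h⟩ ⟨Q', hQ', a', b', h'⟩
        exact ⟨Q ⊞ Q', inferInstance, biprod.lift a a', biprod.desc b b', by
          rw [biprod.lift_desc, ← h, ← h', sub_add_sub_cancel]⟩ }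

/-- The projectively stable category: the objects of `C`, with morphisms taken modulo those
which factor through a projective object. -/
abbrev Stable := CategoryTheory.Quotient (stableRel C)

/-- The quotient functor `A ↦ A`, `f ↦ [f]` from `C` to its stable category. -/
abbrev toStable : C ⥤ Stable C := CategoryTheory.Quotient.functor (stableRel C)

variable {C} [EnoughProjectives C]

/-- The syzygy `Ω A`, the kernel of the chosen epimorphism onto `A` from a projective object. -/
noncomputable def syzygy (A : C) : C := kernel (Projective.π A)

/-- The inclusion of `Ω A` in the chosen projective object over `A`. -/
noncomputable def syzygyι (A : C) : syzygy A ⟶ Projective.over A := kernel.ι (Projective.π A)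

/-- A chosen lift of `f : A ⟶ B` to the chosen projective objects over `A` and `B`. -/
noncomputable def overMap {A B : C} (f : A ⟶ B) : Projective.over A ⟶ Projective.over B :=
  Projective.factorThru (Projective.π A ≫ f) (Projective.π B)

set_option linter.unusedSectionVars false in
lemma overMap_π {A B : C} (f : A ⟶ B) :
    overMap f ≫ Projective.π B = Projective.π A ≫ f :=
  Projective.factorThru_comp _ _

/-- The morphism `Ω A ⟶ Ω B` induced on kernels by the chosen lift of `f : A ⟶ B`. -/
noncomputable def syzygyMap {A B : C} (f : A ⟶ B) : syzygy A ⟶ syzygy B :=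
  kernel.map (Projective.π A) (Projective.π B) (overMap f) f (overMap_π f).symm

lemma syzygyMap_ι {A B : C} (f : A ⟶ B) :
    syzygyMap f ≫ syzygyι B = syzygyι A ≫ overMap f :=
  kernel.lift_ι _ _ _

/-- Morphisms between syzygies which lie over stably equal morphisms are stably equal. -/
lemma stableRel_syzygy {A B : C} {f f' : A ⟶ B} (hf : stableRel C f f')
    {k k' : syzygy A ⟶ syzygy B} {h h' : Projective.over A ⟶ Projective.over B}
    (hk : k ≫ syzygyι B = syzygyι A ≫ h) (hk' : k' ≫ syzygyι B = syzygyι A ≫ h')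
    (hh : h ≫ Projective.π B = Projective.π A ≫ f)
    (hh' : h' ≫ Projective.π B = Projective.π A ≫ f') :
    stableRel C k k' := by
  obtain ⟨Q, hQ, a, b, hab⟩ := hf
  have ht : (h - h' - Projective.π A ≫ a ≫ Projective.factorThru b (Projective.π B)) ≫
      Projective.π B = 0 := by
    simp only [Preadditive.sub_comp, Category.assoc, Projective.factorThru_comp, hh, hh', ← hab,
      Preadditive.comp_sub, sub_self]
  have hz : syzygyι A ≫ Projective.π A = 0 := kernel.condition _
  have hm : Mono (syzygyι B) := inferInstanceAs (Mono (kernel.ι (Projective.π B)))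
  obtain ⟨t, h_t⟩ : ∃ t : Projective.over A ⟶ syzygy B, t ≫ syzygyι B =
      h - h' - Projective.π A ≫ a ≫ Projective.factorThru b (Projective.π B) :=
    ⟨kernel.lift (Projective.π B) _ ht, kernel.lift_ι _ _ _⟩
  refine ⟨Projective.over A, inferInstance, syzygyι A, t, ?_⟩
  rw [← cancel_mono (syzygyι B), Preadditive.sub_comp, hk, hk', Category.assoc, h_t,
    Preadditive.comp_sub, Preadditive.comp_sub, reassoc_of% hz, zero_comp, sub_zero]

variable (C)

/-- The syzygy as a functor from `C` to its stable category. -/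
noncomputable def syzygyFunctor : C ⥤ Stable C where
  obj A := (toStable C).obj (syzygy A)
  map f := (toStable C).map (syzygyMap f)
  map_id A := by
    rw [← (toStable C).map_id]
    exact CategoryTheory.Quotient.sound _ (stableRel_syzygy
      ((inferInstance : Congruence (stableRel C)).equivalence.refl (𝟙 A)) (syzygyMap_ι _)
      (h' := 𝟙 _) (by simp) (overMap_π _) (by simp))
  map_comp {X Y Z} f g := by
    rw [← (toStable C).map_comp]
    exact CategoryTheory.Quotient.sound _ (stableRel_syzygy
      ((inferInstance : Congruence (stableRel C)).equivalence.refl (f ≫ g)) (syzygyMap_ι _)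
      (h' := overMap f ≫ overMap g)
      (by rw [Category.assoc, syzygyMap_ι, ← Category.assoc, syzygyMap_ι, Category.assoc])
      (overMap_π _)
      (by rw [Category.assoc, overMap_π, ← Category.assoc, overMap_π, Category.assoc]))

/-- The syzygy functor `Ω` on the stable category. -/
noncomputable def Omega : Stable C ⥤ Stable C :=
  CategoryTheory.Quotient.lift (stableRel C) (syzygyFunctor C) fun _ _ f f' hf =>
    CategoryTheory.Quotient.sound _
      (stableRel_syzygy hf (syzygyMap_ι f) (syzygyMap_ι f') (overMap_π f) (overMap_π f'))

/-- The forgetful functor from the costabilization of the stable category to the stable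
category. -/
noncomputable abbrev R : Costabilization (Omega C) ⥤ Stable C :=
  Costabilization.forget (Omega C)

/-- `C` is `P`-Co-Gorenstein: the forgetful functor `R` from the costabilization is full and
faithful, and its essential image is closed under extensions in `C`. -/
structure IsCoGorenstein : Prop where
  full : (R C).Full
  faithful : (R C).Faithful
  ext_closed : ∀ S : ShortComplex C, S.ShortExact →
    (R C).essImage ((toStable C).obj S.X₁) → (R C).essImage ((toStable C).obj S.X₃) →
      (R C).essImage ((toStable C).obj S.X₂)

/-- The objects `A` such that `Ext^1(A, P) = 0` for every projective object `P`. -/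
def leftPerpOne : ObjectProperty C := fun A =>
  haveI : HasExt.{v} C := hasExt_of_enoughProjectives.{v} C
  ∀ P : C, Projective P → Subsingleton (Abelian.Ext.{v} A P 1)

/-- The objects `A` such that `Ext^i(A, P) = 0` for every projective object `P` and `i ≥ 1`. -/
def leftPerp : ObjectProperty C := fun A =>
  haveI : HasExt.{v} C := hasExt_of_enoughProjectives.{v} C
  ∀ P : C, Projective P → ∀ i : ℕ, 1 ≤ i → Subsingleton (Abelian.Ext.{v} A P i)

end Stable

section Classes

variable (C : Type u) [Category.{v} C] [Abelian C]

/-- The objects `A` admitting an exact sequence `0 ⟶ A ⟶ P_0 ⟶ P_1 ⟶ ⋯` with all `P_i`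
projective. -/
def omegaInfty : ObjectProperty C := fun A =>
  ∃ (P : CochainComplex C ℕ) (ι : A ⟶ P.X 0) (w : ι ≫ P.d 0 1 = 0),
    (∀ n, Projective (P.X n)) ∧ Mono ι ∧ (ShortComplex.mk ι (P.d 0 1) w).Exact ∧
      ∀ n : ℕ, P.ExactAt (n + 1)

variable {C}

/-- An acyclic complex of projective objects, indexed by `ℤ`, is totally acyclic if it stays
acyclic after applying `Hom(-, Q)` for every projective object `Q`. -/
structure IsTotallyAcyclic (P : CochainComplex C ℤ) : Prop where
  projective : ∀ n, Projective (P.X n)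
  acyclic : P.Acyclic
  hom_acyclic : ∀ Q : C, Projective Q →
    (((preadditiveYoneda.obj Q).mapHomologicalComplex _).obj P.op).Acyclic

variable (C)

/-- The Gorenstein projective objects: the cycles in degree `0` of totally acyclic complexes. -/
def gorensteinProjective : ObjectProperty C := fun A =>
  ∃ P : CochainComplex C ℤ, IsTotallyAcyclic P ∧ Nonempty (A ≅ P.cycles 0)

end Classes

end CoGor

namespace CoGor

/-! Everything passes through condition 2, the vanishing of Ext¹(A, P) for A in Ω^∞. An object of
Ω^∞ continues to a sequence of syzygies over ℤ, and stably isomorphic objects become isomorphic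
after adding projectives; so im R is Ω^∞ up to projective summands.

2 → 1: if Ext¹(A, P) = 0 for all projective P, then Ω is bijective on stable morphisms out of A
(`Omega_map_bijective`), so a morphism of the costabilization amounts to its component in degree 0.
Extension closure is a horseshoe argument for cosyzygies, again by Ext¹ = 0.

1 → 2: push 0 → ΩA → P → A → 0 out along k : ΩA → Q with Q projective, giving 0 → Q → E → A → 0.
Here E lies in im R, and Ω(E → A) is an isomorphism because the kernel Q is projective. Full
faithfulness of R makes Ω reflect isomorphisms on im R, so E → A is a stable isomorphism; being epi,
it splits, and k extends to P.

2 → 3 is dimension shifting. 2 → 4 splices the ℤ-indexed syzygies into a totally acyclic complex; 4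
→ 2 holds because Hom-acyclicity kills Ext¹ of the cycles. -/

/-- A family indexed by `ℤ` whose consecutive members are related can be built from its member
in degree `0`, if the relation is total in both directions. -/
theorem exists_int_family {α : ℤ → Type*} (r : ∀ n, α n → α (n + 1) → Prop)
    (up : ∀ n a, ∃ b, r n a b) (down : ∀ n b, ∃ a, r n a b) (a₀ : α 0) :
    ∃ z : ∀ n, α n, z 0 = a₀ ∧ ∀ n, r n (z n) (z (n + 1)) := by
  choose u hu using up
  choose d hd using down
  let zp : ∀ n : ℕ, α (Int.ofNat n) := fun n => Nat.rec a₀ (fun k a => u (Int.ofNat k) a) n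
  let zn : ∀ n : ℕ, α (Int.negSucc n) := fun n =>
    Nat.rec (d (Int.negSucc 0) a₀) (fun k a => d (Int.negSucc (k + 1)) a) n
  refine ⟨fun n => match n with | .ofNat n => zp n | .negSucc n => zn n, rfl, ?_⟩
  rintro (n | _ | n)
  · exact hu _ _
  · exact hd (Int.negSucc 0) a₀
  · exact hd (Int.negSucc (n + 1)) (zn n)

namespace Costabilization

variable {D : Type u} [Category.{v} D] {T : D ⥤ D}

/-- The compatibility squares always determine f_n from f_{n+1}; bijectivity of `T` on morphisms
lets them determine f_{n+1} from f_n as well. -/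
theorem forget_map_bijective {X Y : Costabilization T}
    (h : ∀ n, Function.Bijective (T.map : (X.obj n ⟶ Y.obj n) → _)) :
    Function.Bijective ((forget T).map : (X ⟶ Y) → _) := by
  constructor
  · intro f g hfg
    have down : ∀ n, f.hom (n + 1) = g.hom (n + 1) → f.hom n = g.hom n := fun n e => by
      rw [← cancel_mono (Y.iso n).hom, f.comm, g.comm, e]
    have up : ∀ n, f.hom n = g.hom n → f.hom (n + 1) = g.hom (n + 1) := fun n e => by
      apply (h (n + 1)).1
      rw [← cancel_epi (X.iso n).hom, ← f.comm, ← g.comm, e]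
    refine Hom.ext (funext fun n => ?_)
    induction n using Int.induction_on with
    | zero => exact hfg
    | succ n ih => exact up _ ih
    | pred n ih => exact down _ (by rwa [sub_add_cancel])
  · intro f
    obtain ⟨z, hz, hr⟩ := exists_int_family
      (fun n (a : X.obj n ⟶ Y.obj n) (b : X.obj (n + 1) ⟶ Y.obj (n + 1)) =>
        a ≫ (Y.iso n).hom = (X.iso n).hom ≫ T.map b)
      (fun n a => by
        obtain ⟨b, hb⟩ := (h (n + 1)).2 ((X.iso n).inv ≫ a ≫ (Y.iso n).hom)
        exact ⟨b, by simp [hb]⟩)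
      (fun n b => ⟨(X.iso n).hom ≫ T.map b ≫ (Y.iso n).inv, by simp⟩) f
    exact ⟨⟨z, hr⟩, hz⟩

variable (T) in
/-- The endofunctor of the costabilization which applies `T` in each degree. -/
def mapFunctor : Costabilization T ⥤ Costabilization T where
  obj X := { obj := fun n => T.obj (X.obj n), iso := fun n => T.mapIso (X.iso n) }
  map f :=
    { hom := fun n => T.map (Hom.hom f n)
      comm := fun n => by simp only [Functor.mapIso_hom, ← T.map_comp, Hom.comm f] }
  map_id X := Hom.ext (funext fun n => T.map_id _)
  map_comp f g := Hom.ext (funext fun n => T.map_comp _ _)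

/-- Degreewise `T f` is an isomorphism in degree 0, hence in every degree by full faithfulness. Its
component `T f₁` agrees with f₀ up to the structure isomorphisms. -/
theorem isIso_forget_map [(forget T).Full] [(forget T).Faithful] {X Y : Costabilization T}
    (f : X ⟶ Y) [hf : IsIso (T.map ((forget T).map f))] : IsIso ((forget T).map f) := by
  have : IsIso ((forget T).map ((mapFunctor T).map f)) := hf
  have : IsIso ((mapFunctor T).map f) := isIso_of_fully_faithful (forget T) _
  let e := asIso ((mapFunctor T).map f)
  have : IsIso (T.map (f.hom (0 + 1))) :=
    ⟨e.inv.hom (0 + 1), congrFun (congrArg Hom.hom e.hom_inv_id) (0 + 1),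
      congrFun (congrArg Hom.hom e.inv_hom_id) (0 + 1)⟩
  have h : f.hom 0 = (X.iso 0).hom ≫ T.map (f.hom (0 + 1)) ≫ (Y.iso 0).inv := by
    rw [← Category.assoc, ← f.comm, Category.assoc, Iso.hom_inv_id, Category.comp_id]
  change IsIso (f.hom 0)
  rw [h]
  infer_instance

end Costabilization

/-! ### Syzygies and Ω^∞ -/

section Syzygies

variable {C : Type u} [Category.{v} C] [Abelian C]

/-- There is a short exact sequence `0 ⟶ A ⟶ X ⟶ B ⟶ 0` with `X` projective. -/
def IsSyzygyOf (A B : C) : Prop :=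
  ∃ (X : C) (f : A ⟶ X) (g : X ⟶ B) (w : f ≫ g = 0),
    Projective X ∧ (ShortComplex.mk f g w).ShortExact

theorem shortExact_biprod_map {S S' : ShortComplex C} (hS : S.ShortExact) (hS' : S'.ShortExact) :
    (ShortComplex.mk (biprod.map S.f S'.f) (biprod.map S.g S'.g)
      (by ext <;> simp)).ShortExact := by
  have := hS.mono_f
  have := hS'.mono_f
  have := hS.epi_g
  have := hS'.epi_g
  have hk : IsLimit (KernelFork.ofι (biprod.map S.f S'.f)
      (show _ ≫ biprod.map S.g S'.g = 0 by ext <;> simp)) := by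
    refine KernelFork.IsLimit.ofι' _ _ fun {A} k hk => ?_
    have h₁ : (k ≫ biprod.fst) ≫ S.g = 0 := by simpa using hk =≫ biprod.fst
    have h₂ : (k ≫ biprod.snd) ≫ S'.g = 0 := by simpa using hk =≫ biprod.snd
    exact ⟨biprod.lift (hS.exact.lift _ h₁) (hS'.exact.lift _ h₂), by
      ext
      · simp
      · simp⟩
  exact .mk' (ShortComplex.exact_of_f_is_kernel _ hk) inferInstance inferInstance

namespace IsSyzygyOf

theorem of_iso {A B A' B' : C} (h : IsSyzygyOf A B) (e : A ≅ A') (e' : B ≅ B') :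
    IsSyzygyOf A' B' := by
  obtain ⟨X, f, g, w, hX, hS⟩ := h
  refine ⟨X, e.inv ≫ f, g ≫ e'.hom, by simp [reassoc_of% w], hX, ?_⟩
  exact ShortComplex.shortExact_of_iso (S₁ := .mk f g w) (S₂ := .mk (e.inv ≫ f) (g ≫ e'.hom) _)
    (ShortComplex.isoMk e (Iso.refl _) e') hS

theorem biprod {A B A' B' : C} (h : IsSyzygyOf A B) (h' : IsSyzygyOf A' B') :
    IsSyzygyOf (A ⊞ A') (B ⊞ B') := by
  obtain ⟨X, f, g, w, hX, hS⟩ := h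
  obtain ⟨X', f', g', w', hX', hS'⟩ := h'
  exact ⟨X ⊞ X', _, _, _, inferInstance, shortExact_biprod_map hS hS'⟩

open scoped ZeroObject in
theorem zero_left (P : C) [Projective P] : IsSyzygyOf 0 P :=
  ⟨P, 0, 𝟙 P, by simp, inferInstance,
    ShortComplex.Splitting.shortExact { r := 0, s := 𝟙 P, f_r := (isZero_zero C).eq_of_src _ _ }⟩

open scoped ZeroObject in
theorem zero_right (P : C) [Projective P] : IsSyzygyOf P 0 :=
  ⟨P, 𝟙 P, 0, by simp, inferInstance,
    ShortComplex.Splitting.shortExact { r := 𝟙 P, s := 0, s_g := (isZero_zero C).eq_of_src _ _ }⟩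

open scoped ZeroObject in
theorem biprod_right {A B : C} (h : IsSyzygyOf A B) (P : C) [Projective P] :
    IsSyzygyOf A (B ⊞ P) :=
  (h.biprod (zero_left P)).of_iso (isoBiprodZero (isZero_zero C)).symm (Iso.refl _)

open scoped ZeroObject in
theorem biprod_left {A B : C} (h : IsSyzygyOf A B) (P : C) [Projective P] :
    IsSyzygyOf (A ⊞ P) B :=
  (h.biprod (zero_right P)).of_iso (Iso.refl _) (isoBiprodZero (isZero_zero C)).symm

end IsSyzygyOf

theorem exact_epi_comp_comp_mono {W A X B Y : C} {f : A ⟶ X} {g : X ⟶ B} {w : f ≫ g = 0}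
    (h : (ShortComplex.mk f g w).Exact) {p : W ⟶ A} {i : B ⟶ Y} [Epi p] [Mono i]
    {f' : W ⟶ X} {g' : X ⟶ Y} (hf : p ≫ f = f') (hg : g ≫ i = g') (w' : f' ≫ g' = 0) :
    (ShortComplex.mk f' g' w').Exact := by
  subst hf hg
  rw [ShortComplex.exact_iff_of_epi_of_isIso_of_mono (S₁ := .mk (p ≫ f) (g ≫ i) w')
    (S₂ := .mk f (g ≫ i) (by simp [reassoc_of% w]))
      { τ₁ := p, τ₂ := 𝟙 _, τ₃ := 𝟙 _ }]
  exact (ShortComplex.exact_iff_of_epi_of_isIso_of_mono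
    (S₁ := .mk f g w) (S₂ := .mk f (g ≫ i) _) { τ₁ := 𝟙 _, τ₂ := 𝟙 _, τ₃ := i }).1 h

/-- A coinduction principle: choose cosyzygies inside `S` repeatedly and splice the short exact
sequences. -/
theorem le_omegaInfty {S : ObjectProperty C} (h : ∀ A, S A → ∃ B, IsSyzygyOf A B ∧ S B) :
    S ≤ omegaInfty C := by
  intro A hA
  choose B hB hSB using h
  let s : ℕ → {A // S A} := fun n => Nat.rec ⟨A, hA⟩ (fun _ a => ⟨B a.1 a.2, hSB _ _⟩) n
  have hs : ∀ n, IsSyzygyOf (s n).1 (s (n + 1)).1 := fun n => hB _ _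
  choose X f g w hX hse using hs
  have hf : ∀ n, Mono (f n) := fun n => (hse n).mono_f
  have hg : ∀ n, Epi (g n) := fun n => (hse n).epi_g
  let P : CochainComplex C ℕ := CochainComplex.of X (fun n => g n ≫ f (n + 1)) fun n => by
    simp [reassoc_of% (w (n + 1))]
  have hd : ∀ n, P.d n (n + 1) = g n ≫ f (n + 1) := CochainComplex.of_d _ _
  refine ⟨P, f 0, ?_, hX, hf 0, ?_, fun n => ?_⟩
  · exact (congrArg (f 0 ≫ ·) (hd 0)).trans (by simp [reassoc_of% (w 0)])
  · exact exact_epi_comp_comp_mono (hse 0).exact (p := 𝟙 _) (by simp) (hd 0).symm _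
  · rw [P.exactAt_iff' n (n + 1) (n + 1 + 1) (by simp) (by simp)]
    exact exact_epi_comp_comp_mono (hse (n + 1)).exact (hd n).symm (hd (n + 1)).symm _

theorem omegaInfty_of_iso {A A' : C} (e : A ≅ A') (h : omegaInfty C A) : omegaInfty C A' := by
  obtain ⟨P, ι, w, hP, hι, hex, hP'⟩ := h
  exact ⟨P, e.inv ≫ ι, by simp [w], hP, inferInstance,
    exact_epi_comp_comp_mono hex (p := e.inv) (i := 𝟙 _) rfl (by simp) _, hP'⟩

theorem exists_isSyzygyOf_omegaInfty {A : C} (h : omegaInfty C A) :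
    ∃ B, IsSyzygyOf A B ∧ omegaInfty C B := by
  obtain ⟨P, ι, w, hP, hι, hex, hP'⟩ := h
  have h₁ := fun n => (P.exactAt_iff' n (n + 1) (n + 1 + 1) (by simp) (by simp)).1 (hP' n)
  -- The cosyzygy is the image of P₀ → P₁, realised by exactness as the kernel of P₁ → P₂.
  let q : P.X 0 ⟶ kernel (P.d 1 2) := kernel.lift _ (P.d 0 1) (by simp)
  have hq : q ≫ kernel.ι _ = P.d 0 1 := kernel.lift_ι _ _ _
  have hwq : ι ≫ q = 0 := by rw [← cancel_mono (kernel.ι _), Category.assoc, hq, w, zero_comp]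
  have : Epi q := (h₁ 0).epi_kernelLift
  let P' : CochainComplex C ℕ := CochainComplex.of (fun n => P.X (n + 1))
    (fun n => P.d (n + 1) (n + 1 + 1)) (by simp)
  have hd : ∀ n, P'.d n (n + 1) = P.d (n + 1) (n + 1 + 1) := CochainComplex.of_d _ _
  refine ⟨kernel (P.d 1 2), ⟨P.X 0, ι, q, hwq, hP 0, .mk' ?_ hι this⟩, P', kernel.ι (P.d 1 2), ?_,
    fun n => hP _, inferInstance, ?_, fun n => ?_⟩
  · exact (ShortComplex.exact_iff_of_epi_of_isIso_of_mono
      (S₁ := .mk ι q hwq) (S₂ := .mk ι (P.d 0 1) w)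
      { τ₁ := 𝟙 _, τ₂ := 𝟙 _, τ₃ := kernel.ι _ }).2 hex
  · exact (congrArg (kernel.ι (P.d 1 2) ≫ ·) (hd 0)).trans (kernel.condition _)
  · exact exact_epi_comp_comp_mono (ShortComplex.exact_kernel (P.d 1 2)) (p := 𝟙 _) (i := 𝟙 _)
      (by simp) ((Category.comp_id _).trans (hd 0).symm) _
  · rw [P'.exactAt_iff' n (n + 1) (n + 1 + 1) (by simp) (by simp)]
    exact exact_epi_comp_comp_mono (h₁ (n + 1)) (p := 𝟙 _) (i := 𝟙 _)
      ((Category.id_comp _).trans (hd n).symm) ((Category.comp_id _).trans (hd (n + 1)).symm) _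

theorem IsSyzygyOf.omegaInfty {A B : C} (h : IsSyzygyOf A B) (hB : omegaInfty C B) :
    omegaInfty C A :=
  le_omegaInfty (S := fun A => ∃ B, IsSyzygyOf A B ∧ CoGor.omegaInfty C B)
    (fun _ ⟨B, hA, hB⟩ => ⟨B, hA, exists_isSyzygyOf_omegaInfty hB⟩) _ ⟨B, h, hB⟩

theorem syzygy_isSyzygyOf [EnoughProjectives C] (A : C) : IsSyzygyOf (syzygy A) A :=
  ⟨Projective.over A, kernel.ι _, Projective.π A, kernel.condition _, inferInstance,
    .mk' (ShortComplex.exact_kernel _) (inferInstanceAs (Mono (kernel.ι _)))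
      (inferInstanceAs (Epi (Projective.π A)))⟩

theorem exists_int_omegaInfty [EnoughProjectives C] {A : C} (hA : omegaInfty C A) :
    ∃ Z : ℤ → C, Z 0 = A ∧ (∀ n, omegaInfty C (Z n)) ∧ ∀ n, IsSyzygyOf (Z n) (Z (n + 1)) := by
  obtain ⟨z, hz, hr⟩ := exists_int_family (α := fun _ => {A : C // omegaInfty C A})
    (fun _ a b => IsSyzygyOf a.1 b.1)
    (fun n a => let ⟨B, hB, hB'⟩ := exists_isSyzygyOf_omegaInfty a.2; ⟨⟨B, hB'⟩, hB⟩)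
    (fun n b => ⟨⟨syzygy b.1, (syzygy_isSyzygyOf b.1).omegaInfty b.2⟩, syzygy_isSyzygyOf b.1⟩)
    ⟨A, hA⟩
  exact ⟨fun n => (z n).1, congrArg Subtype.val hz, fun n => (z n).2, hr⟩

end Syzygies

/-! ### Lifting along projectives and stable isomorphisms -/

section Lifting

variable {C : Type u} [Category.{v} C] [Abelian C]

theorem exists_hom_τ₃_eq {S S' : ShortComplex C} (hS' : S'.ShortExact)
    (hP : Projective S.X₂) (h : S.X₃ ⟶ S'.X₃) : ∃ φ : S ⟶ S', φ.τ₃ = h := by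
  have := hS'.mono_f
  have := hS'.epi_g
  have hl : (S.f ≫ Projective.factorThru (S.g ≫ h) S'.g) ≫ S'.g = 0 := by simp
  exact ⟨{ τ₁ := hS'.exact.lift _ hl, τ₂ := Projective.factorThru (S.g ≫ h) S'.g, τ₃ := h }, rfl⟩

/-- After subtracting a lift of the factorization through `Q`, the difference of the middle maps
lands in `S'.X₁`; so the difference on `S.X₁` factors through `S.X₂`. -/
theorem stableRel_τ₁ {S S' : ShortComplex C} (hS' : S'.ShortExact)
    (hP : Projective S.X₂) {φ φ' : S ⟶ S'} (h : stableRel C φ.τ₃ φ'.τ₃) :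
    stableRel C φ.τ₁ φ'.τ₁ := by
  obtain ⟨Q, hQ, a, b, hab⟩ := h
  have := hS'.mono_f
  have := hS'.epi_g
  have ht : (φ.τ₂ - φ'.τ₂ - S.g ≫ a ≫ Projective.factorThru b S'.g) ≫ S'.g = 0 := by
    simp only [Preadditive.sub_comp, Category.assoc, Projective.factorThru_comp, φ.comm₂₃,
      φ'.comm₂₃, ← hab, Preadditive.comp_sub, sub_self]
  refine ⟨S.X₂, hP, S.f, hS'.exact.lift _ ht, ?_⟩
  rw [← cancel_mono S'.f, Category.assoc, hS'.exact.lift_f]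
  simp [φ.comm₁₂, φ'.comm₁₂]

theorem stableRel_refl {A B : C} (f : A ⟶ B) : stableRel C f f :=
  (inferInstance : Congruence (stableRel C)).equivalence.refl f

theorem isIso_toStable_map_τ₁ {S S' : ShortComplex C} (hS : S.ShortExact) (hS' : S'.ShortExact)
    (hP : Projective S.X₂) (hP' : Projective S'.X₂) (φ : S ⟶ S') [IsIso φ.τ₃] :
    IsIso ((toStable C).map φ.τ₁) := by
  obtain ⟨ψ, hψ⟩ := exists_hom_τ₃_eq hS hP' (inv φ.τ₃)
  refine ⟨(toStable C).map ψ.τ₁, ?_, ?_⟩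
  · rw [← Functor.map_comp, ← (toStable C).map_id]
    exact CategoryTheory.Quotient.sound _ (stableRel_τ₁ hS hP (φ := φ ≫ ψ) (φ' := 𝟙 _)
      (by simpa [hψ] using stableRel_refl _))
  · rw [← Functor.map_comp, ← (toStable C).map_id]
    exact CategoryTheory.Quotient.sound _ (stableRel_τ₁ hS' hP' (φ := ψ ≫ φ) (φ' := 𝟙 _)
      (by simpa [hψ] using stableRel_refl _))

theorem IsSyzygyOf.nonempty_stable_iso {A A' B : C} (h : IsSyzygyOf A B) (h' : IsSyzygyOf A' B) :
    Nonempty ((toStable C).obj A ≅ (toStable C).obj A') := by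
  obtain ⟨X, f, g, w, hX, hS⟩ := h
  obtain ⟨X', f', g', w', hX', hS'⟩ := h'
  obtain ⟨φ, hφ⟩ := exists_hom_τ₃_eq (S := .mk f g w) hS' hX (𝟙 B)
  have : IsIso φ.τ₃ := by rw [hφ]; exact inferInstanceAs (IsIso (𝟙 B))
  have := isIso_toStable_map_τ₁ hS hS' hX hX' φ
  exact ⟨asIso ((toStable C).map φ.τ₁)⟩

theorem exists_biprod_iso {A K : C} (e : (toStable C).obj A ≅ (toStable C).obj K) :
    ∃ Q P : C, Projective Q ∧ Projective P ∧ Nonempty (A ⊞ Q ≅ K ⊞ P) := by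
  obtain ⟨f, hf⟩ := (toStable C).map_surjective e.hom
  obtain ⟨g, hg⟩ := (toStable C).map_surjective e.inv
  have h₁ : stableRel C (𝟙 K) (g ≫ f) := (CategoryTheory.Quotient.functor_map_eq_iff _ _ _).1 (by
    simp [hf, hg])
  have h₂ : stableRel C (𝟙 A) (f ≫ g) := (CategoryTheory.Quotient.functor_map_eq_iff _ _ _).1 (by
    simp [hf, hg])
  obtain ⟨Q, hQ, a, b, hab⟩ := h₁
  obtain ⟨Q', hQ', c, d, hcd⟩ := h₂
  let p : A ⊞ Q ⟶ K := biprod.desc f b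
  let s : K ⟶ A ⊞ Q := biprod.lift g a
  have hsp : s ≫ p = 𝟙 K := by simp [s, p, ← hab]
  let S := ShortComplex.mk (kernel.ι p) p (kernel.condition p)
  let σ : S.Splitting := .ofExactOfSection S (ShortComplex.exact_kernel p) s hsp
    (inferInstanceAs (Mono (kernel.ι p)))
  have hk : (kernel.ι p ≫ biprod.fst) ≫ f = - (kernel.ι p ≫ biprod.snd ≫ b) := by
    rw [eq_neg_iff_add_eq_zero, ← kernel.condition p]
    simp [p, biprod.desc_eq]
  -- On the kernel, with x, y the components in `A`, `Q`, one has xf = -yb. Since 1 - fg = cd, this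
  -- gives x = xcd - ybg, so the identity factors through `Q' ⊞ Q`.
  have hP : Projective (kernel p) := Retract.projective (Y := Q' ⊞ Q)
    { i := biprod.lift (kernel.ι p ≫ biprod.fst ≫ c) (kernel.ι p ≫ biprod.snd)
      r := biprod.desc (d ≫ biprod.inl ≫ σ.r) ((biprod.inr - b ≫ g ≫ biprod.inl) ≫ σ.r)
      retract := by
        have hr : kernel.ι p ≫ σ.r = 𝟙 _ := σ.f_r
        have h3 := hk =≫ (g ≫ biprod.inl ≫ σ.r)
        simp only [Category.assoc, Preadditive.neg_comp] at h3
        have h4 : c ≫ d ≫ biprod.inl ≫ σ.r =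
            biprod.inl ≫ σ.r - f ≫ g ≫ biprod.inl ≫ σ.r := by
          rw [← Category.assoc, ← hcd]; simp
        have h5 : kernel.ι p ≫ biprod.fst ≫ biprod.inl ≫ σ.r +
            kernel.ι p ≫ biprod.snd ≫ biprod.inr ≫ σ.r = 𝟙 _ := by
          rw [← hr, ← Preadditive.comp_add, ← Category.assoc biprod.fst,
            ← Category.assoc biprod.snd, ← Preadditive.add_comp, biprod.total, Category.id_comp]
        simp only [biprod.lift_desc, Category.assoc, h4, Preadditive.comp_sub,
          Preadditive.sub_comp, h3, ← h5]
        abel }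
  exact ⟨Q, kernel p, hQ, hP, ⟨σ.isoBinaryBiproduct ≪≫ biprod.braiding _ _⟩⟩

end Lifting

/-! ### The essential image of R is Ω^∞ up to projective summands -/

section EssImage

variable {C : Type u} [Category.{v} C] [Abelian C] [EnoughProjectives C]

theorem exists_isSyzygyOf_of_stable_iso {A B : C}
    (e : (toStable C).obj A ≅ (Omega C).obj ((toStable C).obj B)) :
    ∃ P : C, Projective P ∧ IsSyzygyOf (A ⊞ P) B := by
  obtain ⟨Q, P, hQ, hP, ⟨i⟩⟩ := exists_biprod_iso (K := syzygy B) e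
  exact ⟨Q, hQ, ((syzygy_isSyzygyOf B).biprod_left P).of_iso i.symm (Iso.refl _)⟩

theorem essImage_of_omegaInfty {A : C} (hA : omegaInfty C A) :
    (R C).essImage ((toStable C).obj A) := by
  obtain ⟨Z, rfl, -, hZ⟩ := exists_int_omegaInfty hA
  let X : Costabilization (Omega C) :=
    { obj := fun n => (toStable C).obj (Z n)
      iso := fun n => ((hZ n).nonempty_stable_iso (syzygy_isSyzygyOf (Z (n + 1)))).some }
  exact ⟨X, ⟨Iso.refl _⟩⟩

theorem exists_omegaInfty_biprod (X : Costabilization (Omega C)) {n : ℤ} {A : C}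
    (e : (toStable C).obj A ≅ X.obj n) : ∃ P : C, Projective P ∧ omegaInfty C (A ⊞ P) := by
  have step : ∀ {n : ℤ} {A : C}, ((toStable C).obj A ≅ X.obj n) →
      ∃ P : C, Projective P ∧ IsSyzygyOf (A ⊞ P) (X.obj (n + 1)).as := fun {n A} e =>
    exists_isSyzygyOf_of_stable_iso (B := (X.obj (n + 1)).as) (e ≪≫ X.iso n)
  obtain ⟨P, hP, hA⟩ := step e
  refine ⟨P, hP, le_omegaInfty (S := fun B => ∃ (n : ℤ) (A : C), IsSyzygyOf B A ∧
    Nonempty ((toStable C).obj A ≅ X.obj n)) ?_ _ ⟨n + 1, _, hA, ⟨Iso.refl _⟩⟩⟩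
  rintro B ⟨n, A, hB, ⟨e⟩⟩
  obtain ⟨P, hP, hA⟩ := step e
  -- Enlarging the middle term by `P` makes `B` a syzygy of `A ⊞ P`, so no further summand has to be
  -- added to `B`.
  exact ⟨A ⊞ P, hB.biprod_right P, n + 1, _, hA, ⟨Iso.refl _⟩⟩

theorem exists_omegaInfty_biprod_of_essImage {A : C} (h : (R C).essImage ((toStable C).obj A)) :
    ∃ P : C, Projective P ∧ omegaInfty C (A ⊞ P) := by
  obtain ⟨X, ⟨e⟩⟩ := h
  exact exists_omegaInfty_biprod X (n := 0) e.symm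

theorem essImage_of_omegaInfty_biprod {A P : C} [Projective P] (h : omegaInfty C (A ⊞ P)) :
    (R C).essImage ((toStable C).obj A) := by
  have hP : stableRel C (biprod.fst ≫ biprod.inl : A ⊞ P ⟶ A ⊞ P) (𝟙 _) :=
    (inferInstance : Congruence (stableRel C)).equivalence.symm
      ⟨P, inferInstance, biprod.snd, biprod.inr, by rw [sub_eq_iff_eq_add', biprod.total]⟩
  refine (R C).essImage.prop_of_iso ⟨(toStable C).map biprod.fst, (toStable C).map biprod.inl,
    ?_, ?_⟩ (essImage_of_omegaInfty h)
  · rw [← Functor.map_comp, ← (toStable C).map_id]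
    exact CategoryTheory.Quotient.sound _ hP
  · rw [← Functor.map_comp, biprod.inl_fst, (toStable C).map_id]

end EssImage

/-! ### Ext¹ vanishing as extension of morphisms -/

section Ext

variable {C : Type u} [Category.{v} C] [Abelian C] [EnoughProjectives C]

open Abelian

theorem exists_extension_of_leftPerpOne {S : ShortComplex C} (hS : S.ShortExact)
    (h : leftPerpOne C S.X₃) {Q : C} (hQ : Projective Q) (k : S.X₁ ⟶ Q) :
    ∃ l : S.X₂ ⟶ Q, S.f ≫ l = k := by
  have : HasExt.{v} C := hasExt_of_enoughProjectives.{v} C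
  have := h Q hQ
  obtain ⟨x, hx⟩ := Ext.contravariant_sequence_exact₁ hS Q (Ext.mk₀ k) (n₁ := 1) rfl
    (Subsingleton.elim _ _)
  obtain ⟨l, rfl⟩ := Ext.addEquiv₀.symm.surjective x
  refine ⟨l, Ext.addEquiv₀.symm.injective ?_⟩
  simpa using hx

theorem leftPerpOne_of_exists_extension {S : ShortComplex C} (hS : S.ShortExact)
    (hP : Projective S.X₂)
    (h : ∀ Q : C, Projective Q → ∀ k : S.X₁ ⟶ Q, ∃ l : S.X₂ ⟶ Q, S.f ≫ l = k) :
    leftPerpOne C S.X₃ := by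
  have : HasExt.{v} C := hasExt_of_enoughProjectives.{v} C
  intro Q hQ
  refine subsingleton_of_forall_eq 0 fun x => ?_
  obtain ⟨y, rfl⟩ := Ext.contravariant_sequence_exact₃ hS Q x (Ext.eq_zero_of_projective _)
    (n₀ := 0) rfl
  obtain ⟨k, rfl⟩ := Ext.addEquiv₀.symm.surjective y
  obtain ⟨l, rfl⟩ := h Q hQ k
  simp [← Ext.mk₀_comp_mk₀]

theorem leftPerpOne_of_retract {A B : C} (r : Retract A B) (h : leftPerpOne C B) :
    leftPerpOne C A := by
  have : HasExt.{v} C := hasExt_of_enoughProjectives.{v} C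
  intro Q hQ
  have := h Q hQ
  refine subsingleton_of_forall_eq 0 fun x => ?_
  have hx : (Ext.mk₀ r.r).comp x (zero_add 1) = 0 := Subsingleton.elim _ _
  have := congrArg (fun y => (Ext.mk₀ r.i).comp y (zero_add 1)) hx
  simpa using this

theorem omegaInfty_le_leftPerp (h : omegaInfty C ≤ leftPerpOne C) :
    omegaInfty C ≤ leftPerp C := by
  have key : ∀ (n : ℕ) (A : C), omegaInfty C A →
      haveI : HasExt.{v} C := hasExt_of_enoughProjectives.{v} C
      ∀ P : C, Projective P → Subsingleton (Ext.{v} A P (n + 1)) := by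
    intro n
    induction n with
    | zero => exact h
    | succ n ih =>
      have : HasExt.{v} C := hasExt_of_enoughProjectives.{v} C
      intro A hA P hP
      obtain ⟨X, f, g, w, hX, hS⟩ := syzygy_isSyzygyOf A
      have := ih _ ((syzygy_isSyzygyOf A).omegaInfty hA) P hP
      refine subsingleton_of_forall_eq 0 fun x => ?_
      obtain ⟨y, rfl⟩ := Ext.contravariant_sequence_exact₃ hS P x (Ext.eq_zero_of_projective _)
        (n₀ := n + 1) (by lia)
      rw [Subsingleton.elim y 0, Ext.comp_zero]
  rintro A hA P hP (_ | n) hi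
  · exact absurd hi (by decide)
  · exact key n A hA P hP

end Ext

/-! ### Ω on stable morphisms -/

section Omega

variable {C : Type u} [Category.{v} C] [Abelian C] [EnoughProjectives C]

theorem shortExact_syzygy (A : C) :
    (ShortComplex.mk (syzygyι A) (Projective.π A) (kernel.condition _)).ShortExact :=
  .mk' (ShortComplex.exact_kernel _) (inferInstanceAs (Mono (kernel.ι _)))
    (inferInstanceAs (Epi (Projective.π A)))

theorem Omega_map_bijective {A : C} (hA : leftPerpOne C A) (B : C) :
    Function.Bijective ((Omega C).map : ((toStable C).obj A ⟶ (toStable C).obj B) → _) := by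
  have hse := shortExact_syzygy A
  have hse' := shortExact_syzygy B
  have : Mono (syzygyι B) := hse'.mono_f
  have hw : syzygyι A ≫ Projective.π A = 0 := kernel.condition _
  have hw' : syzygyι B ≫ Projective.π B = 0 := kernel.condition _
  constructor
  · intro f f' hff
    obtain ⟨f, rfl⟩ := (toStable C).map_surjective f
    obtain ⟨f', rfl⟩ := (toStable C).map_surjective f'
    have hs : stableRel C (syzygyMap f) (syzygyMap f') :=
      (CategoryTheory.Quotient.functor_map_eq_iff _ _ _).1 hff
    obtain ⟨Q, hQ, a, b, hab⟩ := hs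
    -- Extending `a` over the projective cover term lets the factorization be subtracted there; the
    -- remainder kills ΩA and descends to a map from `A` through which f - f' factors.
    obtain ⟨a', rfl⟩ := exists_extension_of_leftPerpOne hse hA hQ a
    have h0 : syzygyι A ≫ (overMap f - overMap f' - a' ≫ b ≫ syzygyι B) = 0 := by
      have := hab =≫ syzygyι B
      simp only [Preadditive.sub_comp, syzygyMap_ι, Category.assoc] at this
      simp [this]
    refine CategoryTheory.Quotient.sound _
      ⟨Projective.over B, inferInstance, hse.exact.desc _ h0, Projective.π B, ?_⟩
    rw [← cancel_epi (Projective.π A)]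
    have := hse.exact.g_desc _ h0
    dsimp only at this
    rw [reassoc_of% this]
    simp [overMap_π, hw']
  · intro k
    obtain ⟨k, rfl⟩ := (toStable C).map_surjective (X := syzygy A) (Y := syzygy B) k
    obtain ⟨l, hl⟩ := exists_extension_of_leftPerpOne hse hA inferInstance (k ≫ syzygyι B)
    dsimp only at hl
    have h0 : syzygyι A ≫ l ≫ Projective.π B = 0 := by
      rw [reassoc_of% hl, hw', comp_zero]
    refine ⟨(toStable C).map (hse.exact.desc _ h0), CategoryTheory.Quotient.sound _
      (stableRel_syzygy (stableRel_refl _)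
        (syzygyMap_ι _) hl.symm (overMap_π _) (hse.exact.g_desc _ h0).symm)⟩

end Omega

/-! ### Totally acyclic complexes -/

section GorensteinProjective

variable {C : Type u} [Category.{v} C] [Abelian C]

theorem epi_toCycles_of_exactAt (K : CochainComplex C ℤ) {i j : ℤ}
    (hi : (ComplexShape.up ℤ).prev j = i) (h : K.ExactAt j) : Epi (K.toCycles i j) := by
  subst hi
  have : Epi (K.sc j).toCycles := ShortComplex.Exact.epi_toCycles h
  exact this

theorem shortExact_cycles {K : CochainComplex C ℤ} (hK : K.Acyclic) (n : ℤ) :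
    (ShortComplex.mk (K.iCycles n) (K.toCycles n (n + 1)) (by
      rw [← cancel_mono (K.iCycles (n + 1))]; simp)).ShortExact := by
  have : Epi (K.toCycles n (n + 1)) := epi_toCycles_of_exactAt K (by simp) (hK _)
  refine .mk' ?_ (inferInstanceAs (Mono (K.iCycles n))) this
  exact (ShortComplex.exact_iff_of_epi_of_isIso_of_mono
    (S₁ := .mk (K.iCycles n) (K.toCycles n (n + 1)) _)
    (S₂ := .mk (K.iCycles n) (K.d n (n + 1)) (by simp))
    { τ₁ := 𝟙 _, τ₂ := 𝟙 _, τ₃ := K.iCycles (n + 1) }).2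
    (ShortComplex.exact_of_f_is_kernel _ (K.cyclesIsKernel n (n + 1) (by simp)))

theorem gorensteinProjective_le_omegaInfty : gorensteinProjective C ≤ omegaInfty C := by
  rintro A ⟨P, hP, ⟨e⟩⟩
  refine omegaInfty_of_iso e.symm
    (le_omegaInfty (S := fun B => ∃ n, B = P.cycles n) ?_ _ ⟨0, rfl⟩)
  rintro _ ⟨n, rfl⟩
  exact ⟨_, ⟨P.X n, _, _, _, hP.projective n, shortExact_cycles hP.acyclic n⟩, n + 1, rfl⟩

theorem acyclic_hom_iff (P : CochainComplex C ℤ) (Q : C) :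
    (((preadditiveYoneda.obj Q).mapHomologicalComplex _).obj P.op).Acyclic ↔
      ∀ (n : ℤ) (k : P.X (n + 1) ⟶ Q), P.d n (n + 1) ≫ k = 0 →
        ∃ l : P.X (n + 1 + 1) ⟶ Q, P.d (n + 1) (n + 1 + 1) ≫ l = k := by
  have key : ∀ n : ℤ,
      (((preadditiveYoneda.obj Q).mapHomologicalComplex _).obj P.op).ExactAt (n + 1) ↔
      ∀ k : P.X (n + 1) ⟶ Q, P.d n (n + 1) ≫ k = 0 →
        ∃ l : P.X (n + 1 + 1) ⟶ Q, P.d (n + 1) (n + 1 + 1) ≫ l = k := fun n => by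
    rw [HomologicalComplex.exactAt_iff' _ (n + 1 + 1) (n + 1) n
      (ComplexShape.prev_eq' _ (by simp)) (ComplexShape.next_eq' _ (by simp)),
      ShortComplex.ab_exact_iff]
    exact Iff.rfl
  refine ⟨fun h n => (key n).1 (h _), fun h n => ?_⟩
  obtain ⟨m, rfl⟩ : ∃ m, n = m + 1 := ⟨n - 1, by simp⟩
  exact (key m).2 (h m)

variable [EnoughProjectives C]

theorem IsTotallyAcyclic.leftPerpOne_cycles {P : CochainComplex C ℤ} (hP : IsTotallyAcyclic P)
    (n : ℤ) : leftPerpOne C (P.cycles n) := by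
  -- Three steps of room: `k` starts at the cycles in degree m+2, is pulled back to degree m+1, and
  -- is then killed by the differential from degree m.
  obtain ⟨m, rfl⟩ : ∃ m, n = m + 1 + 1 + 1 := ⟨n - 1 - 1 - 1, by simp⟩
  refine leftPerpOne_of_exists_extension (shortExact_cycles hP.acyclic (m + 1 + 1))
    (hP.projective _) fun Q hQ k => ?_
  dsimp only at k ⊢
  have : Epi (P.toCycles (m + 1) (m + 1 + 1)) :=
    epi_toCycles_of_exactAt P (by simp) (hP.acyclic _)
  obtain ⟨l, hl⟩ := (acyclic_hom_iff P Q).1 (hP.hom_acyclic Q hQ) m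
    (P.toCycles (m + 1) (m + 1 + 1) ≫ k) (by simp)
  exact ⟨l, by rw [← cancel_epi (P.toCycles (m + 1) (m + 1 + 1)), ← hl, P.toCycles_i_assoc]⟩

theorem gorensteinProjective_le_leftPerpOne : gorensteinProjective C ≤ leftPerpOne C := by
  rintro A ⟨P, hP, ⟨e⟩⟩
  exact leftPerpOne_of_retract (Retract.ofIso e) (hP.leftPerpOne_cycles 0)

theorem omegaInfty_le_gorensteinProjective (h : omegaInfty C ≤ leftPerpOne C) :
    omegaInfty C ≤ gorensteinProjective C := by
  intro A hA
  obtain ⟨Z, rfl, hZ, hs⟩ := exists_int_omegaInfty hA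
  choose X f g w hX hse using hs
  have hf : ∀ n, Mono (f n) := fun n => (hse n).mono_f
  have hg : ∀ n, Epi (g n) := fun n => (hse n).epi_g
  let K : CochainComplex C ℤ := CochainComplex.of X (fun n => g n ≫ f (n + 1)) fun n => by
    simp [reassoc_of% (w (n + 1))]
  have hd : ∀ n, K.d n (n + 1) = g n ≫ f (n + 1) := CochainComplex.of_d _ _
  refine ⟨K, ⟨hX, fun n => ?_, fun Q hQ => (acyclic_hom_iff K Q).2 fun n k hk => ?_⟩, ⟨?_⟩⟩
  · obtain ⟨m, rfl⟩ : ∃ m, n = m + 1 := ⟨n - 1, by simp⟩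
    rw [K.exactAt_iff' m (m + 1) (m + 1 + 1) (by simp) (by simp)]
    exact exact_epi_comp_comp_mono (hse (m + 1)).exact (hd m).symm (hd (m + 1)).symm _
  · change X (n + 1) ⟶ Q at k
    have hk' : f (n + 1) ≫ k = 0 := by
      rw [← cancel_epi (g n), comp_zero, ← Category.assoc]
      exact (congrArg (· ≫ k) (hd n)).symm.trans hk
    -- The cocycle descends to the syzygy in degree n+2, and extends from there because the
    -- cokernel, the syzygy in degree n+3, is in Ω^∞.
    obtain ⟨l, hl⟩ := exists_extension_of_leftPerpOne (hse (n + 1 + 1)) (h _ (hZ _)) hQ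
      ((hse (n + 1)).exact.desc k hk')
    refine ⟨l, (congrArg (· ≫ l) (hd (n + 1))).trans ?_⟩
    exact (Category.assoc _ _ _).trans
      ((congrArg (g (n + 1) ≫ ·) hl).trans ((hse (n + 1)).exact.g_desc k hk'))
  · exact IsLimit.conePointUniqueUpToIso
      (exact_epi_comp_comp_mono (hse 0).exact (p := 𝟙 _) (Category.id_comp _) (hd 0).symm
        ((congrArg (f 0 ≫ ·) (hd 0)).trans (by simp [reassoc_of% (w 0)]))).fIsKernel
      (K.cyclesIsKernel 0 (0 + 1) (by simp))

end GorensteinProjective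

/-! ### Closure under extensions -/

section Extensions

variable {C : Type u} [Category.{v} C] [Abelian C] [EnoughProjectives C]

/-- The extension `u` of `i` gives a monomorphism from `S` to the split sequence on `X ⊞ Y`; the
snake lemma makes its cokernel short exact. -/
theorem exists_shortExact_cosyzygies {S : ShortComplex C} (hS : S.ShortExact)
    (h : leftPerpOne C S.X₃) {A B : C} (hA : IsSyzygyOf S.X₁ A) (hB : IsSyzygyOf S.X₃ B) :
    ∃ T : ShortComplex C, T.ShortExact ∧ Nonempty (T.X₁ ≅ A) ∧ Nonempty (T.X₃ ≅ B) ∧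
      IsSyzygyOf S.X₂ T.X₂ := by
  obtain ⟨X, i, p, w, hX, hi⟩ := hA
  obtain ⟨Y, j, q, w', hY, hj⟩ := hB
  obtain ⟨u, hu⟩ := exists_extension_of_leftPerpOne hS h hX i
  let L : ShortComplex C := ShortComplex.mk (biprod.inl : X ⟶ X ⊞ Y) biprod.snd (by simp)
  have hL : L.ShortExact :=
    ShortComplex.Splitting.shortExact { r := biprod.fst, s := biprod.inr, id := biprod.total }
  let φ : S ⟶ L :=
    { τ₁ := i
      τ₂ := biprod.lift u (S.g ≫ j)
      τ₃ := j
      comm₁₂ := by ext <;> simp [L, hu]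
      comm₂₃ := by simp [L] }
  have := hS.epi_g
  have := hS.mono_f
  have := hL.mono_f
  have := hL.epi_g
  have hφ₁ : Mono φ.τ₁ := hi.mono_f
  have hφ₃ : Mono φ.τ₃ := hj.mono_f
  have hφ₂ : Mono φ.τ₂ := ShortComplex.mono_τ₂_of_exact_of_mono φ hS.exact
  let D : ShortComplex.SnakeInput C :=
    { L₀ := kernel φ, L₁ := S, L₂ := L, L₃ := cokernel φ
      v₀₁ := kernel.ι φ, v₁₂ := φ, v₂₃ := cokernel.π φ
      w₀₂ := kernel.condition φ, w₁₃ := cokernel.condition φ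
      h₀ := kernelIsKernel φ, h₃ := cokernelIsCokernel φ
      L₁_exact := hS.exact, L₂_exact := hL.exact
      epi_L₁_g := hS.epi_g, mono_L₂_f := hL.mono_f }
  have : Mono D.v₀₁.τ₃ := mono_of_isLimit_fork D.h₀τ₃
  have hz : IsZero D.L₀.X₃ := by
    rw [IsZero.iff_id_eq_zero, ← cancel_mono D.v₀₁.τ₃, ← cancel_mono φ.τ₃, Category.assoc]
    rw [Category.id_comp, zero_comp, zero_comp]
    exact D.w₀₂_τ₃
  have hm : Mono D.L₃.f := D.L₂'_exact.mono_g (hz.eq_of_src _ _)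
  have he : Epi D.L₃.g := D.epi_L₃_g
  exact ⟨D.L₃, .mk' D.L₃_exact hm he,
    ⟨IsColimit.coconePointUniqueUpToIso D.h₃τ₁ hi.gIsCokernel⟩,
    ⟨IsColimit.coconePointUniqueUpToIso D.h₃τ₃ hj.gIsCokernel⟩,
    X ⊞ Y, φ.τ₂, D.v₂₃.τ₂, _, inferInstance, .mk' D.exact_C₂_down hφ₂ D.epi_v₂₃_τ₂⟩

theorem omegaInfty_of_shortExact (h : omegaInfty C ≤ leftPerpOne C) {S : ShortComplex C}
    (hS : S.ShortExact) (h₁ : omegaInfty C S.X₁) (h₃ : omegaInfty C S.X₃) :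
    omegaInfty C S.X₂ := by
  refine le_omegaInfty (S := fun A => ∃ S : ShortComplex C, S.ShortExact ∧ omegaInfty C S.X₁ ∧
    omegaInfty C S.X₃ ∧ A = S.X₂) ?_ _ ⟨S, hS, h₁, h₃, rfl⟩
  rintro _ ⟨S, hS, h₁, h₃, rfl⟩
  obtain ⟨A, hA, hA'⟩ := exists_isSyzygyOf_omegaInfty h₁
  obtain ⟨B, hB, hB'⟩ := exists_isSyzygyOf_omegaInfty h₃
  obtain ⟨T, hT, ⟨e₁⟩, ⟨e₃⟩, hT'⟩ := exists_shortExact_cosyzygies hS (h _ h₃) hA hB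
  exact ⟨_, hT', T, hT, omegaInfty_of_iso e₁.symm hA', omegaInfty_of_iso e₃.symm hB', rfl⟩

theorem isCoGorenstein_of_omegaInfty_le (h : omegaInfty C ≤ leftPerpOne C) :
    IsCoGorenstein C := by
  have hb : ∀ X Y : Costabilization (Omega C), Function.Bijective ((R C).map : (X ⟶ Y) → _) :=
    fun X Y => Costabilization.forget_map_bijective fun n => by
      obtain ⟨P, hP, hA⟩ := exists_omegaInfty_biprod X (A := (X.obj n).as) (Iso.refl _)
      exact Omega_map_bijective (leftPerpOne_of_retract
        { i := biprod.inl, r := biprod.fst } (h _ hA)) (Y.obj n).as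
  refine ⟨⟨fun {X Y} => (hb X Y).2⟩, ⟨fun {X Y} => @(hb X Y).1⟩, fun S hS h₁ h₃ => ?_⟩
  obtain ⟨P, hP, hA⟩ := exists_omegaInfty_biprod_of_essImage h₁
  obtain ⟨Q, hQ, hB⟩ := exists_omegaInfty_biprod_of_essImage h₃
  -- Adding this split sequence to `S` moves both end terms into Ω^∞.
  have hL : (ShortComplex.mk (biprod.inl : P ⟶ P ⊞ Q) biprod.snd (by simp)).ShortExact :=
    ShortComplex.Splitting.shortExact { r := biprod.fst, s := biprod.inr, id := biprod.total }
  exact essImage_of_omegaInfty_biprod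
    (omegaInfty_of_shortExact h (shortExact_biprod_map hS hL) hA hB)

end Extensions

/-! ### Splitting extensions by projectives -/

section Splitting

variable {C : Type u} [Category.{v} C] [Abelian C]

theorem omegaInfty_of_projective {P : C} (hP : Projective P) : omegaInfty C P := by
  open scoped ZeroObject in
  exact le_omegaInfty (S := fun P => Projective P)
    (fun P _ => ⟨0, .zero_right P, inferInstance⟩) _ hP

theorem exists_section_of_isIso_toStable_map {E A : C} (p : E ⟶ A) [Epi p]
    [IsIso ((toStable C).map p)] : ∃ s : A ⟶ E, s ≫ p = 𝟙 A := by
  obtain ⟨g, hg⟩ := (toStable C).map_surjective (inv ((toStable C).map p))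
  obtain ⟨Q, hQ, a, b, hab⟩ : stableRel C (𝟙 A) (g ≫ p) :=
    (CategoryTheory.Quotient.functor_map_eq_iff _ _ _).1 (by simp [hg])
  -- The stable inverse `g` is a section up to ab; lifting `b` along the epimorphism `p` corrects
  -- it.
  exact ⟨g + a ≫ Projective.factorThru b p, by simp [← hab]⟩

theorem shortExact_pushout {S : ShortComplex C} (hS : S.ShortExact) {Q : C} (k : S.X₁ ⟶ Q) :
    (ShortComplex.mk (pushout.inr S.f k) (pushout.desc S.g 0 (by simp))
      (pushout.inr_desc _ _ _)).ShortExact := by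
  have := hS.mono_f
  have := hS.epi_g
  have he : Epi (pushout.desc S.g (0 : Q ⟶ S.X₃) (by simp) : pushout S.f k ⟶ S.X₃) := by
    have : Epi (pushout.inl S.f k ≫ pushout.desc S.g (0 : Q ⟶ S.X₃) (by simp)) := by
      rw [pushout.inl_desc]; infer_instance
    exact epi_of_epi (pushout.inl S.f k) _
  refine .mk' (ShortComplex.exact_of_g_is_cokernel _
    (CokernelCofork.IsColimit.ofπ' _ _ fun {Z} z hz => ?_))
    (inferInstanceAs (Mono (pushout.inr S.f k))) he
  dsimp only at z hz
  have h0 : S.f ≫ pushout.inl S.f k ≫ z = 0 := by rw [pushout.condition_assoc, hz, comp_zero]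
  exact ⟨hS.exact.desc _ h0, by
    apply pushout.hom_ext
    · rw [pushout.inl_desc_assoc, hS.exact.g_desc]
    · rw [pushout.inr_desc_assoc, zero_comp, hz]⟩

variable [EnoughProjectives C]

/-- Pulling back gives 0 → ΩX₃ → X₁ ⊞ P → X₂ → 0 with projective middle term, so ΩX₃ is also a
syzygy of X₂. The comparison ΩX₃ → ΩX₂ is a stable isomorphism, and Ω of `S.g` is its inverse. -/
theorem isIso_Omega_map {S : ShortComplex C} (hS : S.ShortExact) (hP : Projective S.X₁) :
    IsIso ((Omega C).map ((toStable C).map S.g)) := by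
  have := hS.mono_f
  have := hS.epi_g
  have hA := shortExact_syzygy S.X₃
  have hE := shortExact_syzygy S.X₂
  have : Mono (syzygyι S.X₃) := hA.mono_f
  have hw : syzygyι S.X₃ ≫ Projective.π S.X₃ = 0 := kernel.condition _
  let q := Projective.factorThru (Projective.π S.X₃) S.g
  have hq : q ≫ S.g = Projective.π S.X₃ := Projective.factorThru_comp _ _
  have h0 : (syzygyι S.X₃ ≫ q) ≫ S.g = 0 := by rw [Category.assoc, hq, hw]
  let t := hS.exact.lift _ h0
  have ht : t ≫ S.f = syzygyι S.X₃ ≫ q := hS.exact.lift_f _ h0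
  let T : ShortComplex C := ShortComplex.mk (biprod.lift (-t) (syzygyι S.X₃))
    (biprod.desc S.f q) (by simp [ht])
  have hk : IsLimit (KernelFork.ofι T.f T.zero) := by
    refine KernelFork.IsLimit.ofι' _ _ fun {A} k hk => ?_
    have hk₀ : (k ≫ biprod.fst) ≫ S.f + (k ≫ biprod.snd) ≫ q = 0 := by
      rw [← hk]; simp [T, biprod.desc_eq]
    have hk₁ : (k ≫ biprod.snd) ≫ Projective.π S.X₃ = 0 := by
      have := hk₀ =≫ S.g
      simpa [hq] using this
    let m := hA.exact.lift _ hk₁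
    have hm : m ≫ syzygyι S.X₃ = k ≫ biprod.snd := hA.exact.lift_f _ hk₁
    refine ⟨m, ?_⟩
    ext
    · rw [← cancel_mono S.f, eq_neg_of_add_eq_zero_left hk₀, ← hm]
      simp [T, ht]
    · simpa [T] using hm
  have he : Epi T.g := by
    refine Preadditive.epi_of_cancel_zero _ fun {Z} z hz => ?_
    have h₁ : S.f ≫ z = 0 := by simpa [T] using biprod.inl ≫= hz
    have h₂ : q ≫ z = 0 := by simpa [T] using biprod.inr ≫= hz
    have h₃ : hS.exact.desc z h₁ = 0 := by
      rw [← cancel_epi (Projective.π S.X₃), ← hq, Category.assoc, hS.exact.g_desc, h₂, comp_zero]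
    rw [← hS.exact.g_desc z h₁, h₃, comp_zero]
  have hT : T.ShortExact :=
    .mk' (ShortComplex.exact_of_f_is_kernel _ hk) (mono_of_isLimit_fork hk) he
  have hTP : Projective T.X₂ := inferInstanceAs (Projective (S.X₁ ⊞ Projective.over S.X₃))
  obtain ⟨φ, hφ⟩ := exists_hom_τ₃_eq (S := T) hE hTP (𝟙 _)
  have : IsIso φ.τ₃ := by rw [hφ]; exact inferInstanceAs (IsIso (𝟙 S.X₂))
  have := isIso_toStable_map_τ₁ hT hE hTP (Projective.projective_over _) φ
  let Φ : ShortComplex.mk (syzygyι S.X₂) (Projective.π S.X₂) (kernel.condition _) ⟶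
      ShortComplex.mk (syzygyι S.X₃) (Projective.π S.X₃) (kernel.condition _) :=
    { τ₁ := syzygyMap S.g, τ₂ := overMap S.g, τ₃ := S.g
      comm₁₂ := syzygyMap_ι _, comm₂₃ := overMap_π _ }
  -- Both `β` and `φ ≫ Φ` lie over `S.g`, so their first components agree stably; that of `β` is the
  -- identity.
  let β : T ⟶ ShortComplex.mk (syzygyι S.X₃) (Projective.π S.X₃) (kernel.condition _) :=
    { τ₁ := 𝟙 _, τ₂ := biprod.snd, τ₃ := S.g
      comm₁₂ := by simp [T]
      comm₂₃ := by ext <;> simp [T, hq] }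
  have hcomp : (toStable C).map φ.τ₁ ≫ (Omega C).map ((toStable C).map S.g) = 𝟙 _ :=
    (((toStable C).map_comp φ.τ₁ (syzygyMap S.g)).symm.trans
      (CategoryTheory.Quotient.sound _ (stableRel_τ₁ hA hTP (φ := φ ≫ Φ) (φ' := β)
        (by simpa [hφ, Φ, β] using stableRel_refl _)))).trans ((toStable C).map_id _)
  have : IsIso ((toStable C).map φ.τ₁ ≫ (Omega C).map ((toStable C).map S.g)) := by
    rw [hcomp]
    exact inferInstanceAs (IsIso (𝟙 _))
  exact IsIso.of_isIso_comp_left ((toStable C).map φ.τ₁) _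

theorem isIso_of_isIso_Omega_map [(R C).Full] [(R C).Faithful] {A B : Stable C}
    (hA : (R C).essImage A) (hB : (R C).essImage B) (f : A ⟶ B) [IsIso ((Omega C).map f)] :
    IsIso f := by
  obtain ⟨X, ⟨e⟩⟩ := hA
  obtain ⟨Y, ⟨e'⟩⟩ := hB
  obtain ⟨φ, hφ⟩ := (R C).map_surjective (e.hom ≫ f ≫ e'.inv)
  have : IsIso ((Omega C).map ((R C).map φ)) := by
    rw [hφ, Functor.map_comp, Functor.map_comp]
    infer_instance
  have := Costabilization.isIso_forget_map φ
  have hf : f = e.inv ≫ (R C).map φ ≫ e'.hom := by simp [hφ]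
  rw [hf]
  infer_instance

theorem IsCoGorenstein.omegaInfty_le (h : IsCoGorenstein C) :
    omegaInfty C ≤ leftPerpOne C := by
  intro A hA
  have := h.full
  have := h.faithful
  have hse := shortExact_syzygy A
  refine leftPerpOne_of_exists_extension hse (Projective.projective_over A) fun Q hQ k => ?_
  have hT := shortExact_pushout hse k
  have hE := h.ext_closed _ hT (essImage_of_omegaInfty (omegaInfty_of_projective hQ))
    (essImage_of_omegaInfty hA)
  let p : pushout (syzygyι A) k ⟶ A := pushout.desc (Projective.π A) 0 (by
    rw [comp_zero]; exact kernel.condition _)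
  have : IsIso ((Omega C).map ((toStable C).map p)) := isIso_Omega_map hT hQ
  have := isIso_of_isIso_Omega_map hE (essImage_of_omegaInfty hA) ((toStable C).map p)
  have : Epi p := hT.epi_g
  obtain ⟨s, hs⟩ := exists_section_of_isIso_toStable_map p
  -- The section yields a retraction of the pushout onto `Q`, which restricts to the required
  -- extension of `k`.
  let σ := ShortComplex.Splitting.ofExactOfSection _ hT.exact s hs hT.mono_f
  exact ⟨pushout.inl _ k ≫ σ.r, by
    rw [pushout.condition_assoc]
    exact (congrArg (k ≫ ·) σ.f_r).trans (Category.comp_id k)⟩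

end Splitting

end CoGor

theorem mainTheorem1 {C : Type u} [Category.{v} C] [Abelian C] [EnoughProjectives C] :
    List.TFAE
      [CoGor.IsCoGorenstein C,
        CoGor.omegaInfty C ≤ CoGor.leftPerpOne C,
        CoGor.omegaInfty C ≤ CoGor.leftPerp C,
        CoGor.omegaInfty C = CoGor.gorensteinProjective C] := by
  tfae_have 1 → 2 := CoGor.IsCoGorenstein.omegaInfty_le
  tfae_have 2 → 1 := CoGor.isCoGorenstein_of_omegaInfty_le
  tfae_have 2 → 3 := CoGor.omegaInfty_le_leftPerp
  tfae_have 3 → 2 := fun h A hA P hP => h A hA P hP 1 le_rfl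
  tfae_have 2 → 4 := fun h =>
    le_antisymm (CoGor.omegaInfty_le_gorensteinProjective h)
      CoGor.gorensteinProjective_le_omegaInfty
  tfae_have 4 → 2 := fun h => h.le.trans CoGor.gorensteinProjective_le_leftPerpOne
  tfae_finish
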